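/- For a positive integer $t$, let $F_{t,t}$ denote the $t\times t$ grid: the graph with vertex set $[t]\times[t]$ in which two vertices are joined by an edge if they differ in exactly one coordinate and in that coordinate they differ by one. For a graph $F$, let $\mathrm{ex}(n,F)$ denote the maximum number of edges in an $n$-vertex graph that does not contain $F$ as a (not necessarily induced) subgraph. Then for every positive integer $t$ there is an integer $n_0=n_0(t)$ such that for all $n\ge n_0$, $$\mathrm{ex}(n,F_{t,t})\le 5\,t^{3/2}\,n^{3/2}.$$ (For $t=1$ and $n\ge 1$ no graph avoids $F_{1,1}$, and the maximum over the empty family is taken to be $0$.) -/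

import Mathlib

/-- The `t × t` grid `F_{t,t}`: the vertices are the pairs in `[t] × [t]`, and two vertices are
adjacent if they differ in exactly one coordinate and in that coordinate they differ by one. -/
def gridGraph (t : ℕ) : SimpleGraph (Fin t × Fin t) where
  Adj p q :=
    (p.1 = q.1 ∧ ((p.2 : ℕ) + 1 = q.2 ∨ (q.2 : ℕ) + 1 = p.2)) ∨
    (p.2 = q.2 ∧ ((p.1 : ℕ) + 1 = q.1 ∨ (q.1 : ℕ) + 1 = p.1))
  symm := ⟨fun p q h => by
    rcases h with ⟨h, h'⟩ | ⟨h, h'⟩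
    · exact Or.inl ⟨h.symm, h'.symm⟩
    · exact Or.inr ⟨h.symm, h'.symm⟩⟩
  loopless := ⟨fun p h => by omega⟩

/-! ### Sequences satisfying a Cauchy–Schwarz inequality -/

section CauchySchwarzSequence

variable {W : ℕ → ℝ}

/-! Suppose some nonempty family of walks on `2 * t - 1` vertices lets any single vertex be
exchanged for one outside any given set of fewer than `t * t` vertices. Placing the grid in
lexicographic order, with each diagonal assigned to one position of the walk, a new grid vertex is
then one exchange: its left and upper neighbours occupy the two adjacent positions
(`gridGraph_isContained_of_replaceable`). Such a family arises by discarding walks with few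
alternatives at some position (`exists_subset_fibers_large`). Something survives if there are more
walks than `t * t` times the number of walks with one vertex erased. An erased walk is a pair of
shorter walks, and Cauchy–Schwarz for walk counts (`card_walkTuples_sq_le`, `shifted_mul_le`) bounds
the number of pairs at each position by `n ^ 3 / (2 * e) ^ 2` times the number of walks. -/

theorem even_ratio_monotone (hpos : ∀ k, 0 < W k)
    (hcs : ∀ a b, W (a + b) ^ 2 ≤ W (2 * a) * W (2 * b)) (j d : ℕ) :
    W (2 * (j + 1)) / W (2 * j) ≤ W (2 * (j + d + 1)) / W (2 * (j + d)) := by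
  have hmono : Monotone fun j => W (2 * (j + 1)) / W (2 * j) := by
    refine monotone_nat_of_le_succ fun j => ?_
    rw [div_le_div_iff₀ (hpos _) (hpos _)]
    have h := hcs j (j + 2)
    rw [show j + (j + 2) = 2 * (j + 1) by ring] at h
    rw [show j + 1 + 1 = j + 2 by ring]
    nlinarith
  exact hmono (Nat.le_add_right j d)

/-- Log-convexity of the even-indexed terms: the ratios telescope, each being at most its shift by
`x`. -/
theorem even_mul_even_le (hpos : ∀ k, 0 < W k)
    (hcs : ∀ a b, W (a + b) ^ 2 ≤ W (2 * a) * W (2 * b)) (x y : ℕ) :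
    W (2 * x) * W (2 * y) ≤ W 0 * W (2 * (x + y)) := by
  induction y with
  | zero => simp [mul_comm]
  | succ y ih =>
    have h := even_ratio_monotone hpos hcs y x
    rw [add_comm y x, div_le_div_iff₀ (hpos _) (hpos _)] at h
    refine le_of_mul_le_mul_right ?_ (hpos (2 * (x + y)))
    calc W (2 * x) * W (2 * (y + 1)) * W (2 * (x + y))
        = W (2 * x) * (W (2 * (y + 1)) * W (2 * (x + y))) := by ring
      _ ≤ W (2 * x) * (W (2 * (x + y + 1)) * W (2 * y)) :=
          mul_le_mul_of_nonneg_left h (hpos _).le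
      _ = W (2 * x) * W (2 * y) * W (2 * (x + y + 1)) := by ring
      _ ≤ W 0 * W (2 * (x + y)) * W (2 * (x + y + 1)) :=
          mul_le_mul_of_nonneg_right ih (hpos _).le
      _ = W 0 * W (2 * (x + (y + 1))) * W (2 * (x + y)) := by
          rw [show x + (y + 1) = x + y + 1 by ring]; ring

theorem odd_sq_le (hcs : ∀ a b, W (a + b) ^ 2 ≤ W (2 * a) * W (2 * b)) (x : ℕ) :
    W (2 * x + 1) ^ 2 ≤ W (2 * x) * W (2 * (x + 1)) := by
  have h := hcs x (x + 1)
  rwa [show x + (x + 1) = 2 * x + 1 by ring] at h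

/-- Each odd term is at most the geometric mean of its even neighbours; pairing these neighbours
crosswise gives two products with the same index sum. -/
theorem odd_mul_odd_le (hpos : ∀ k, 0 < W k)
    (hcs : ∀ a b, W (a + b) ^ 2 ≤ W (2 * a) * W (2 * b)) (x y : ℕ) :
    W (2 * x + 1) * W (2 * y + 1) ≤ W 0 * W (2 * (x + y + 1)) := by
  have h1 := odd_sq_le hcs x
  have h2 := odd_sq_le hcs y
  have h3 := even_mul_even_le hpos hcs x (y + 1)
  have h4 := even_mul_even_le hpos hcs (x + 1) y
  rw [show x + (y + 1) = x + y + 1 by ring] at h3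
  rw [show x + 1 + y = x + y + 1 by ring] at h4
  refine le_of_sq_le_sq ?_ (mul_pos (hpos _) (hpos _)).le
  calc (W (2 * x + 1) * W (2 * y + 1)) ^ 2
      = W (2 * x + 1) ^ 2 * W (2 * y + 1) ^ 2 := by ring
    _ ≤ (W (2 * x) * W (2 * (x + 1))) * (W (2 * y) * W (2 * (y + 1))) :=
        mul_le_mul h1 h2 (sq_nonneg _) (mul_pos (hpos _) (hpos _)).le
    _ = (W (2 * x) * W (2 * (y + 1))) * (W (2 * (x + 1)) * W (2 * y)) := by ring
    _ ≤ (W 0 * W (2 * (x + y + 1))) * (W 0 * W (2 * (x + y + 1))) :=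
        mul_le_mul h3 h4 (mul_pos (hpos _) (hpos _)).le (mul_pos (hpos _) (hpos _)).le
    _ = _ := by ring

/-- Two extra edges cost a factor `(W 1 / W 0) ^ 2`, since this is at most the first even ratio `W 2
/ W 0`. -/
theorem sq_one_mul_even_le (hpos : ∀ k, 0 < W k)
    (hcs : ∀ a b, W (a + b) ^ 2 ≤ W (2 * a) * W (2 * b)) (j : ℕ) :
    W 1 ^ 2 * W (2 * j) ≤ W 0 ^ 2 * W (2 * (j + 1)) := by
  have h := even_ratio_monotone hpos hcs 0 j
  rw [div_le_div_iff₀ (hpos _) (hpos _)] at h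
  have h1 := odd_sq_le hcs 0
  simp only [Nat.zero_add, Nat.mul_zero, mul_one] at h h1
  nlinarith [mul_le_mul_of_nonneg_right h1 (hpos (2 * j)).le,
    mul_le_mul_of_nonneg_left h (hpos 0).le]

theorem one_mul_odd_le (hpos : ∀ k, 0 < W k)
    (hcs : ∀ a b, W (a + b) ^ 2 ≤ W (2 * a) * W (2 * b)) (j : ℕ) :
    W 1 * W (2 * j + 1) ≤ W 0 * W (2 * (j + 1)) := by
  have h := odd_mul_odd_le hpos hcs 0 j
  simpa using h

/-- If `N (m + 1) = W m` and `N 0 = 1`, then `N p * N (2 * q - p)` is at most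
`(W 0) ^ 3 / (W 1) ^ 2 * W (2 * q)`. -/
theorem shifted_mul_le (hpos : ∀ k, 0 < W k)
    (hcs : ∀ a b, W (a + b) ^ 2 ≤ W (2 * a) * W (2 * b)) (h10 : W 1 ≤ W 0 ^ 2)
    {N : ℕ → ℝ} (hN0 : N 0 = 1) (hN : ∀ m, N (m + 1) = W m) {p r q : ℕ} (hpr : p + r = 2 * q) :
    W 1 ^ 2 * (N p * N r) ≤ W 0 ^ 3 * W (2 * q) := by
  have hend : ∀ j, W 1 ^ 2 * W (2 * j + 1) ≤ W 0 ^ 3 * W (2 * (j + 1)) := fun j => by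
    have h := one_mul_odd_le hpos hcs j
    have h0 := mul_pos (hpos 0) (hpos (2 * (j + 1)))
    calc W 1 ^ 2 * W (2 * j + 1) = W 1 * (W 1 * W (2 * j + 1)) := by ring
      _ ≤ W 0 ^ 2 * (W 0 * W (2 * (j + 1))) :=
        mul_le_mul h10 h (mul_pos (hpos _) (hpos _)).le (sq_nonneg _)
      _ = _ := by ring
  -- An empty piece is not a term of `W`; these end cases are where `h10` is needed. Otherwise `p`
  -- and `r` have equal parity.
  rcases p with _ | p <;> rcases r with _ | r
  · obtain rfl : q = 0 := by omega
    rw [hN0]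
    nlinarith [mul_le_mul h10 h10 (hpos 1).le (sq_nonneg (W 0))]
  · obtain ⟨j, rfl⟩ : ∃ j, q = j + 1 := ⟨q - 1, by omega⟩
    obtain rfl : r = 2 * j + 1 := by omega
    rw [hN0, hN, one_mul]
    exact hend j
  · obtain ⟨j, rfl⟩ : ∃ j, q = j + 1 := ⟨q - 1, by omega⟩
    obtain rfl : p = 2 * j + 1 := by omega
    rw [hN0, hN, mul_one]
    exact hend j
  · obtain ⟨j, rfl⟩ : ∃ j, q = j + 1 := ⟨q - 1, by omega⟩
    have hkey : W p * W r ≤ W 0 * W (2 * j) := by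
      rcases Nat.even_or_odd' p with ⟨x, rfl | rfl⟩
      · obtain rfl : r = 2 * (j - x) := by omega
        have h := even_mul_even_le hpos hcs x (j - x)
        rwa [show x + (j - x) = j by omega] at h
      · obtain rfl : r = 2 * (j - x - 1) + 1 := by omega
        have h := odd_mul_odd_le hpos hcs x (j - x - 1)
        rwa [show x + (j - x - 1) + 1 = j by omega] at h
    rw [hN, hN]
    have h := sq_one_mul_even_le hpos hcs j
    calc W 1 ^ 2 * (W p * W r) ≤ W 1 ^ 2 * (W 0 * W (2 * j)) :=
        mul_le_mul_of_nonneg_left hkey (sq_nonneg _)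
      _ = W 0 * (W 1 ^ 2 * W (2 * j)) := by ring
      _ ≤ W 0 * (W 0 ^ 2 * W (2 * (j + 1))) := mul_le_mul_of_nonneg_left h (hpos 0).le
      _ = _ := by ring

end CauchySchwarzSequence

/-! ### Cleaning a finite set -/

/-- If `A` has more than `s` elements per value of the maps `r i`, then `A` has a nonempty subset
in which every fibre of every `r i` that is met has at least `s` elements. -/
theorem exists_subset_fibers_large {X Y ι : Type*} [DecidableEq X] [DecidableEq Y] [Fintype ι]
    (A : Finset X) (r : ι → X → Y) (s : ℕ) (h : s * ∑ i, (A.image (r i)).card < A.card) :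
    ∃ B ⊆ A, B.Nonempty ∧ ∀ f ∈ B, ∀ i, s ≤ (B.filter fun g => r i g = r i f).card := by
  -- At a maximizer of `Φ` no fibre is smaller than `s`: removing it would lose fewer than `s`
  -- elements but at least one value. Nonemptiness follows from `Φ ∅ = 0 < Φ A`.
  let Φ : Finset X → ℤ := fun B => B.card - s * ∑ i, ((B.image (r i)).card : ℤ)
  obtain ⟨B, hBA, hB⟩ := Finset.exists_max_image A.powerset Φ ⟨A, Finset.mem_powerset_self A⟩
  rw [Finset.mem_powerset] at hBA
  refine ⟨B, hBA, ?_, fun f hf i => ?_⟩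
  · rw [Finset.nonempty_iff_ne_empty]
    rintro rfl
    have h1 := hB A (Finset.mem_powerset_self A)
    simp only [Φ, Finset.card_empty, Finset.image_empty] at h1
    zify at h
    simp at h1
    linarith
  · set F := B.filter fun g => r i g = r i f with hF
    have h1 := hB (B \ F) (Finset.mem_powerset.2 (Finset.sdiff_subset.trans hBA))
    have hcard : ((B \ F).card : ℤ) = B.card - F.card := by
      have := Finset.card_sdiff_add_card_eq_card (Finset.filter_subset (fun g => r i g = r i f) B)
      rw [← hF] at this
      omega
    have hlt : ∑ k, (((B \ F).image (r k)).card : ℤ) < ∑ k, ((B.image (r k)).card : ℤ) := by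
      refine Finset.sum_lt_sum (fun k _ => ?_) ⟨i, Finset.mem_univ i, ?_⟩
      · exact_mod_cast Finset.card_le_card (Finset.image_subset_image Finset.sdiff_subset)
      · refine Int.ofNat_lt.2 (Finset.card_lt_card ?_)
        refine Finset.ssubset_iff_of_subset (Finset.image_subset_image Finset.sdiff_subset) |>.2
          ⟨r i f, Finset.mem_image_of_mem _ hf, ?_⟩
        simp only [Finset.mem_image, Finset.mem_sdiff, hF, Finset.mem_filter, not_exists, not_and]
        rintro g ⟨hg, hg'⟩ hgf
        exact hg' hg hgf
    simp only [Φ] at h1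
    have hs : (0 : ℤ) ≤ s := by positivity
    have := mul_le_mul_of_nonneg_left (Int.add_one_le_iff.2 hlt) hs
    zify
    linarith
-- Counting walks
open Finset in
/-- The sequences of `m` vertices in which consecutive vertices are adjacent. -/
def SimpleGraph.walkTuples {V : Type*} [Fintype V] [DecidableEq V] (G : SimpleGraph V)
    [DecidableRel G.Adj] (m : ℕ) : Finset (Fin m → V) :=
  univ.filter fun f => ∀ i j : Fin m, (i : ℕ) + 1 = j → G.Adj (f i) (f j)

namespace SimpleGraph

open Finset Matrix

variable {V : Type*} [Fintype V] [DecidableEq V] (G : SimpleGraph V) [DecidableRel G.Adj]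

theorem mem_walkTuples {m : ℕ} {f : Fin m → V} :
    f ∈ G.walkTuples m ↔ ∀ i j : Fin m, (i : ℕ) + 1 = j → G.Adj (f i) (f j) := by
  simp [walkTuples]

theorem cons_mem_walkTuples {m : ℕ} (v : V) (g : Fin (m + 1) → V) :
    (Fin.cons v g : Fin (m + 2) → V) ∈ G.walkTuples (m + 2) ↔
      G.Adj v (g 0) ∧ g ∈ G.walkTuples (m + 1) := by
  simp only [mem_walkTuples]
  constructor
  · intro h
    refine ⟨by simpa using h 0 1 (by simp), fun i j hij => ?_⟩
    simpa using h i.succ j.succ (by simp [← hij])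
  · rintro ⟨h0, h⟩ i j hij
    cases j using Fin.cases with
    | zero => simp at hij
    | succ j =>
      cases i using Fin.cases with
      | zero =>
        obtain rfl : j = 0 := by ext; simpa using hij.symm
        simpa using h0
      | succ i => simpa using h i j (by simpa using hij)

theorem walkTuples_nonempty {u v : V} (huv : G.Adj u v) (m : ℕ) : (G.walkTuples m).Nonempty := by
  refine ⟨fun i => if Even (i : ℕ) then u else v, G.mem_walkTuples.2 fun i j hij => ?_⟩
  simp only [← hij, Nat.even_add_one]
  by_cases h : Even (i : ℕ) <;> simp [h, huv, huv.symm]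

theorem card_walkTuples_zero : (G.walkTuples 0).card = 1 := by
  rw [card_eq_one]
  refine ⟨Fin.elim0, ?_⟩
  ext f
  simp [mem_walkTuples, Subsingleton.elim f Fin.elim0]

/-- The weight on the first vertex drives the induction: prepending `v` calls for row `v` of the
adjacency matrix as the weight. -/
theorem sum_walkTuples (m : ℕ) (h : V → ℝ) :
    ∑ f ∈ G.walkTuples (m + 1), h (f 0) = h ⬝ᵥ ((G.adjMatrix ℝ) ^ m *ᵥ 1) := by
  induction m generalizing h with
  | zero =>
    have : G.walkTuples 1 = univ := by
      ext f; simp [mem_walkTuples]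
    simp only [this, pow_zero, one_mulVec, dotProduct, Pi.one_apply, mul_one]
    exact Fintype.sum_equiv (Equiv.funUnique (Fin 1) V) _ _ fun f => by simp
  | succ m ih =>
    have hstep : ∑ f ∈ G.walkTuples (m + 2), h (f 0) =
        ∑ v, h v * ∑ g ∈ G.walkTuples (m + 1), G.adjMatrix ℝ v (g 0) := by
      have hfilter : ∀ k, G.walkTuples k = univ.filter (· ∈ G.walkTuples k) := fun k => by simp
      rw [hfilter (m + 2), hfilter (m + 1), sum_filter,
        ← (Fin.consEquiv fun _ : Fin (m + 2) => V).sum_comp, Fintype.sum_prod_type]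
      refine sum_congr rfl fun v _ => ?_
      rw [sum_filter, mul_sum]
      refine sum_congr rfl fun g _ => ?_
      simp only [Fin.consEquiv, Equiv.coe_fn_mk, cons_mem_walkTuples, Fin.cons_zero,
        adjMatrix_apply]
      by_cases h1 : G.Adj v (g 0) <;> by_cases h2 : g ∈ G.walkTuples (m + 1) <;> simp [h1, h2]
    rw [hstep]
    simp_rw [ih]
    rw [pow_succ', ← mulVec_mulVec]
    rfl

/-- The number of walks with `m` edges, as a real number. -/
theorem card_walkTuples_succ (m : ℕ) :
    ((G.walkTuples (m + 1)).card : ℝ) = 1 ⬝ᵥ ((G.adjMatrix ℝ) ^ m *ᵥ 1) := by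
  rw [← sum_walkTuples]; simp

/-- By symmetry of the adjacency matrix `A`, the left count is the inner product of `A ^ a *ᵥ 1` and
`A ^ b *ᵥ 1`. -/
theorem card_walkTuples_sq_le (a b : ℕ) :
    ((G.walkTuples (a + b + 1)).card : ℝ) ^ 2 ≤
      (G.walkTuples (2 * a + 1)).card * (G.walkTuples (2 * b + 1)).card := by
  have key : ∀ a b, (1 : V → ℝ) ⬝ᵥ ((G.adjMatrix ℝ) ^ (a + b) *ᵥ 1) =
      ((G.adjMatrix ℝ) ^ a *ᵥ 1) ⬝ᵥ ((G.adjMatrix ℝ) ^ b *ᵥ 1) := fun a b => by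
    rw [pow_add, ← mulVec_mulVec, dotProduct_mulVec, ← mulVec_transpose, transpose_pow,
      transpose_adjMatrix]
  simp only [card_walkTuples_succ, two_mul, key]
  have := Finset.sum_mul_sq_le_sq_mul_sq univ ((G.adjMatrix ℝ) ^ a *ᵥ 1)
    ((G.adjMatrix ℝ) ^ b *ᵥ 1)
  simpa only [dotProduct, ← sq] using this

theorem card_walkTuples_one : (G.walkTuples 1).card = Fintype.card V := by
  have := G.card_walkTuples_succ 0
  simp [dotProduct] at this
  exact_mod_cast this

theorem card_walkTuples_two : (G.walkTuples 2).card = 2 * G.edgeFinset.card := by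
  have h := G.card_walkTuples_succ 1
  have h2 := G.sum_degrees_eq_twice_card_edges
  have : ((G.walkTuples 2).card : ℝ) = ((∑ v, G.degree v : ℕ) : ℝ) := by
    rw [h]
    simp [dotProduct]
  rw [← h2]
  exact_mod_cast this

/-- Forgetting the `p`-th vertex of a walk leaves two shorter walks. -/
theorem card_image_update_walkTuples_le (c : V) {k p r : ℕ} (h : p + r = k) :
    ((G.walkTuples (k + 1)).image fun f =>
      Function.update f (⟨p, by omega⟩ : Fin (k + 1)) c).card ≤
      (G.walkTuples p).card * (G.walkTuples r).card := by
  subst h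
  rw [← card_product]
  refine card_le_card_of_injOn
    (fun f => (fun i : Fin p => f ⟨i, by omega⟩, fun i : Fin r => f ⟨p + 1 + i, by omega⟩)) ?_ ?_
  · intro f hf
    simp only [coe_image, Set.mem_image, mem_coe] at hf
    obtain ⟨g, hg, rfl⟩ := hf
    rw [mem_walkTuples] at hg
    simp only [coe_product, Set.mem_prod, mem_coe, mem_walkTuples]
    constructor
    · intro i j hij
      rw [Function.update_of_ne, Function.update_of_ne]
      · exact hg _ _ hij
      all_goals simp [Fin.ext_iff]; omega
    · intro i j hij
      rw [Function.update_of_ne, Function.update_of_ne]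
      · exact hg _ _ (by simp; omega)
      all_goals simp [Fin.ext_iff]; omega
  · intro f hf g hg hfg
    simp only [coe_image, Set.mem_image, mem_coe] at hf hg
    obtain ⟨f, -, rfl⟩ := hf
    obtain ⟨g, -, rfl⟩ := hg
    simp only [Prod.mk.injEq, funext_iff] at hfg
    funext x
    rcases lt_trichotomy (x : ℕ) p with hx | hx | hx
    · exact hfg.1 ⟨x, hx⟩
    · have hx' : x = ⟨p, by omega⟩ := Fin.ext hx
      simp [hx']
    · have := hfg.2 ⟨x - (p + 1), by omega⟩
      have hx' : (⟨p + 1 + (x - (p + 1)), by omega⟩ : Fin (p + r + 1)) = x := by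
        ext; simp; omega
      simpa only [hx'] using this

end SimpleGraph

/-! ### Embedding the grid -/

/-- The position in a walk on `2 * t - 1` vertices at which the `a`-th grid vertex, in the
lexicographic order, is placed. -/
def gridPosition (t a : ℕ) : ℕ := a / t + (t - 1 - a % t)

theorem gridPosition_lt {t a : ℕ} (ht : 0 < t) (ha : a < t * t) :
    gridPosition t a < 2 * (t - 1) + 1 := by
  have := Nat.div_lt_of_lt_mul ha
  unfold gridPosition
  omega

theorem pred_div_mod {t a : ℕ} (ha : a % t ≠ 0) :
    (a - 1) / t = a / t ∧ (a - 1) % t = a % t - 1 := by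
  rcases t.eq_zero_or_pos with rfl | ht
  · simp
  have h1 := Nat.div_add_mod a t
  have h2 := Nat.mod_lt a ht
  rw [Nat.div_mod_unique ht]
  exact ⟨by omega, by omega⟩

theorem sub_div_mod {t a : ℕ} (ht : 0 < t) (ha : t ≤ a) :
    (a - t) / t = a / t - 1 ∧ (a - t) % t = a % t ∧ 1 ≤ a / t :=
  ⟨by rw [Nat.div_eq_sub_div ht ha, Nat.add_sub_cancel], (Nat.mod_eq_sub_mod ha).symm, (Nat.one_le_div_iff ht).2 ha⟩

theorem gridPosition_pred {t a : ℕ} (ht : 0 < t) (ha : a % t ≠ 0) :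
    gridPosition t (a - 1) = gridPosition t a + 1 := by
  have h := pred_div_mod ha
  have := Nat.mod_lt a ht
  unfold gridPosition
  omega

theorem gridPosition_sub {t a : ℕ} (ht : 0 < t) (ha : t ≤ a) :
    gridPosition t (a - t) + 1 = gridPosition t a := by
  have h := sub_div_mod ht ha
  unfold gridPosition
  omega

/-- Later vertices in the row of `a - t` lie on lower diagonals, and those before `a` in its own row
on higher ones. -/
theorem gridPosition_ne_of_between {t a b : ℕ} (ht : 0 < t) (ha : t ≤ a) (h1 : a - t < b)
    (h2 : b < a) : gridPosition t b ≠ gridPosition t (a - t) := by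
  have h := sub_div_mod ht ha
  have ha1 := Nat.div_add_mod a t
  have hb1 := Nat.div_add_mod b t
  have ha2 := Nat.mod_lt a ht
  have hb2 := Nat.mod_lt b ht
  have hle : b / t ≤ a / t := Nat.div_le_div_right h2.le
  have hge : a / t - 1 ≤ b / t := h.1 ▸ Nat.div_le_div_right h1.le
  unfold gridPosition
  rcases (show b / t = a / t ∨ b / t + 1 = a / t by omega) with hb | hb
  · rw [hb] at hb1
    omega
  · rw [← hb, mul_add] at ha1
    omega

open Finset in
/-- Let `B` be a nonempty set of walks on `2 * t - 1` vertices such that every vertex of every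
member of `B` can be replaced by a vertex outside any prescribed set of fewer than `t * t` vertices
without leaving `B`. Then the `t × t` grid is contained in the graph. -/
theorem gridGraph_isContained_of_replaceable {V : Type*} [Fintype V] [DecidableEq V]
    (G : SimpleGraph V) [DecidableRel G.Adj] {t : ℕ} (ht : 0 < t)
    (B : Finset (Fin (2 * (t - 1) + 1) → V)) (hBG : B ⊆ G.walkTuples (2 * (t - 1) + 1))
    (hB : B.Nonempty)
    (hrep : ∀ f ∈ B, ∀ p, ∀ S : Finset V, S.card < t * t →
      ∃ g ∈ B, g p ∉ S ∧ ∀ x, x ≠ p → g x = f x) :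
    (gridGraph t).IsContained G := by
  -- Invariant: at every position used so far, `f` carries the grid vertex placed there most
  -- recently.
  have main : ∀ m ≤ t * t, ∃ f ∈ B, ∃ v : ℕ → V,
      (∀ a < m, ∀ b < m, v a = v b → a = b) ∧
      (∀ a < m, (a % t ≠ 0 → G.Adj (v a) (v (a - 1))) ∧ (t ≤ a → G.Adj (v (a - t)) (v a))) ∧
      (∀ a < m, (∀ b, a < b → b < m → gridPosition t b ≠ gridPosition t a) →
        ∀ x : Fin (2 * (t - 1) + 1), (x : ℕ) = gridPosition t a → f x = v a) := by
    intro m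
    induction m with
    | zero =>
      obtain ⟨f, hf⟩ := hB
      exact fun _ => ⟨f, hf, fun _ => f 0, by simp, by simp, by simp⟩
    | succ m ih =>
      intro hm
      obtain ⟨f, hf, v, hinj, hadj, hpos⟩ := ih (by omega)
      obtain ⟨g, hg, hgS, hgf⟩ := hrep f hf ⟨gridPosition t m, gridPosition_lt ht (by omega)⟩
        ((range m).image v) (card_image_le.trans_lt (by simp; omega))
      have hnew : ∀ a < m, v a ≠ g ⟨gridPosition t m, gridPosition_lt ht (by omega)⟩ :=
        fun a ha h => hgS (h ▸ mem_image_of_mem v (mem_range.2 ha))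
      have hwalk := G.mem_walkTuples.1 (hBG hg)
      have hv : ∀ a < m, Function.update v m
          (g ⟨gridPosition t m, gridPosition_lt ht (by omega)⟩) a = v a :=
        fun a ha => Function.update_of_ne ha.ne _ _
      have hkeep : ∀ a < m, (∀ b, a < b → b < m + 1 → gridPosition t b ≠ gridPosition t a) →
          ∀ x : Fin (2 * (t - 1) + 1), (x : ℕ) = gridPosition t a → g x = v a := by
        intro a ha hb x hx
        rw [hgf x, hpos a ha (fun b h1 h2 => hb b h1 (by omega)) x hx]
        rintro rfl
        exact hb m ha (by omega) hx
      refine ⟨g, hg, Function.update v m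
        (g ⟨gridPosition t m, gridPosition_lt ht (by omega)⟩), ?_, ?_, ?_⟩
      · intro a ha b hb hab
        rcases Nat.lt_succ_iff_lt_or_eq.1 ha with ha | rfl <;>
          rcases Nat.lt_succ_iff_lt_or_eq.1 hb with hb | rfl
        · rw [hv a ha, hv b hb] at hab
          exact hinj a ha b hb hab
        · rw [hv a ha, Function.update_self] at hab
          exact absurd hab (hnew a ha)
        · rw [hv b hb, Function.update_self] at hab
          exact absurd hab.symm (hnew b hb)
        · rfl
      · intro a ha
        rcases Nat.lt_succ_iff_lt_or_eq.1 ha with ha | rfl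
        · rw [hv a ha, hv (a - 1) (by omega), hv (a - t) (by omega)]
          exact hadj a ha
        -- The left and upper neighbours are still the latest on their diagonals, so they lie on `g`
        -- next to the new vertex.
        · constructor
          · intro h0
            have ha0 : a ≠ 0 := by rintro rfl; simp at h0
            have hp := gridPosition_pred ht h0
            have hlt : gridPosition t (a - 1) < 2 * (t - 1) + 1 :=
              gridPosition_lt ht (by omega)
            rw [hv (a - 1) (by omega), Function.update_self,
              ← hkeep (a - 1) (by omega) (fun b h1 h2 => by
                obtain rfl : b = a := by omega
                omega) ⟨_, hlt⟩ rfl]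
            exact hwalk _ _ hp.symm
          · intro hta
            have hp := gridPosition_sub ht hta
            have hlt : gridPosition t (a - t) < 2 * (t - 1) + 1 :=
              gridPosition_lt ht (by omega)
            rw [hv (a - t) (by omega), Function.update_self,
              ← hkeep (a - t) (by omega) (fun b h1 h2 => by
                rcases Nat.lt_succ_iff_lt_or_eq.1 h2 with h2 | rfl
                · exact gridPosition_ne_of_between ht hta h1 h2
                · omega) ⟨_, hlt⟩ rfl]
            exact hwalk _ _ hp
      · intro a ha hb x hx
        rcases Nat.lt_succ_iff_lt_or_eq.1 ha with ha | rfl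
        · rw [hv a ha]
          exact hkeep a ha hb x hx
        · rw [Function.update_self]
          exact congrArg g (Fin.ext hx)
  obtain ⟨-, -, v, hinj, hadj, -⟩ := main (t * t) le_rfl
  have hlt : ∀ p : Fin t × Fin t, (p.1 : ℕ) * t + p.2 < t * t := fun p => by
    have := Nat.mul_le_mul_right t (Nat.succ_le_of_lt p.1.2)
    have := p.2.2
    rw [Nat.succ_mul] at *
    omega
  have hmod : ∀ p : Fin t × Fin t, ((p.1 : ℕ) * t + p.2) % t = p.2 := fun p => by
    rw [mul_comm, Nat.mul_add_mod, Nat.mod_eq_of_lt p.2.2]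
  have hdiv : ∀ p : Fin t × Fin t, ((p.1 : ℕ) * t + p.2) / t = p.1 := fun p => by
    rw [mul_comm, Nat.mul_add_div ht, Nat.div_eq_of_lt p.2.2, add_zero]
  have hrow : ∀ p q : Fin t × Fin t, p.1 = q.1 → (p.2 : ℕ) + 1 = q.2 →
      G.Adj (v (q.1 * t + q.2)) (v (p.1 * t + p.2)) := fun p q h1 h2 => by
    have h := (hadj _ (hlt q)).1 (by rw [hmod]; omega)
    rwa [show (q.1 : ℕ) * t + q.2 - 1 = p.1 * t + p.2 by rw [h1]; omega] at h
  have hcol : ∀ p q : Fin t × Fin t, p.2 = q.2 → (p.1 : ℕ) + 1 = q.1 →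
      G.Adj (v (p.1 * t + p.2)) (v (q.1 * t + q.2)) := fun p q h1 h2 => by
    have heq : (q.1 : ℕ) * t + q.2 = p.1 * t + p.2 + t := by rw [← h2, h1]; ring
    have h := (hadj _ (hlt q)).2 (by omega)
    rwa [show (q.1 : ℕ) * t + q.2 - t = p.1 * t + p.2 by omega] at h
  refine ⟨⟨⟨fun p => v (p.1 * t + p.2), ?_⟩, ?_⟩⟩
  · rintro p q (⟨h, h' | h'⟩ | ⟨h, h' | h'⟩)
    · exact (hrow p q h h').symm
    · exact hrow q p h.symm h'
    · exact hcol p q h h'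
    · exact (hcol q p h.symm h').symm
  · intro p q hpq
    have h := hinj _ (hlt p) _ (hlt q) hpq
    refine Prod.ext (Fin.ext ?_) (Fin.ext ?_)
    · rw [← hdiv p, h, hdiv q]
    · rw [← hmod p, h, hmod q]

open Finset in
/-- If the walks on `2 * t - 1` vertices outnumber `t * t` times the sum over `p` of the number of
pairs of walks obtained by deleting the `p`-th vertex, then the graph contains the grid. -/
theorem gridGraph_isContained_of_card_walkTuples {V : Type*} [Fintype V] [DecidableEq V]
    (G : SimpleGraph V) [DecidableRel G.Adj] {t : ℕ} (ht : 0 < t)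
    (h : t * t * ∑ p : Fin (2 * (t - 1) + 1),
      (G.walkTuples p).card * (G.walkTuples (2 * (t - 1) - p)).card <
        (G.walkTuples (2 * (t - 1) + 1)).card) :
    (gridGraph t).IsContained G := by
  -- `f₀ 0` is only a filler value: overwriting the `p`-th entry by it amounts to erasing that
  -- entry.
  obtain ⟨f₀, -⟩ := card_pos.1 (Nat.zero_le _ |>.trans_lt h)
  obtain ⟨B, hBG, hB, hfib⟩ := exists_subset_fibers_large (G.walkTuples (2 * (t - 1) + 1))
    (fun p f => Function.update f p (f₀ 0)) (t * t) <| by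
      refine (Nat.mul_le_mul_left _ (sum_le_sum fun p _ => ?_)).trans_lt h
      exact G.card_image_update_walkTuples_le (f₀ 0) (p := p) (by omega)
  refine gridGraph_isContained_of_replaceable G ht B hBG hB fun f hf p S hS => ?_
  have hagree : ∀ g, Function.update g p (f₀ 0) = Function.update f p (f₀ 0) →
      ∀ x, x ≠ p → g x = f x := fun g hg x hx => by
    simpa [hx] using congrFun hg x
  -- Otherwise evaluation at `p` would inject a fibre of at least `t * t` walks into `S`.
  by_contra! hcon
  refine (hS.trans_le (hfib f hf p)).not_ge ?_
  refine card_le_card_of_injOn (fun g => g p) ?_ ?_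
  · intro g hg
    simp only [coe_filter, Set.mem_ofPred_eq] at hg
    by_contra hgS
    obtain ⟨x, hx, hne⟩ := hcon g hg.1 hgS
    exact hne (hagree g hg.2 x hx)
  · intro g hg g' hg' hgg'
    simp only [coe_filter, Set.mem_ofPred_eq] at hg hg'
    funext x
    by_cases hx : x = p
    · rw [hx]; exact hgg'
    · rw [hagree g hg.2 x hx, hagree g' hg'.2 x hx]

/-- A graph with `(2 * e) ^ 2 > (2 * t - 1) * t ^ 2 * n ^ 3` contains the `t × t` grid. -/
theorem gridGraph_isContained_of_sq_card_edgeFinset {V : Type*} [Fintype V] [DecidableEq V]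
    (G : SimpleGraph V) [DecidableRel G.Adj] {t : ℕ} (ht : 0 < t)
    (h : (2 * t - 1) * t ^ 2 * (Fintype.card V : ℝ) ^ 3 < (2 * G.edgeFinset.card : ℝ) ^ 2) :
    (gridGraph t).IsContained G := by
  set W : ℕ → ℝ := fun k => ((G.walkTuples (k + 1)).card : ℝ) with hW
  have hcs : ∀ a b, W (a + b) ^ 2 ≤ W (2 * a) * W (2 * b) := G.card_walkTuples_sq_le
  have hW0 : W 0 = Fintype.card V := by simp [hW, G.card_walkTuples_one]
  have hW1 : W 1 = 2 * G.edgeFinset.card := by simp [hW, G.card_walkTuples_two]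
  rw [← hW0, ← hW1] at h
  have ht1 : (1 : ℝ) ≤ t := by exact_mod_cast ht
  have hnonneg : ∀ k, 0 ≤ W k := fun k => Nat.cast_nonneg _
  have hW1sq : 0 < W 1 ^ 2 := lt_of_le_of_lt
    (mul_nonneg (mul_nonneg (by linarith) (sq_nonneg _)) (pow_nonneg (hnonneg 0) 3)) h
  have hpos1 : 0 < W 1 := (hnonneg 1).lt_of_ne (by rintro h0; simp [← h0] at hW1sq)
  have hpos : ∀ k, 0 < W k := fun k => by
    obtain ⟨f, hf⟩ := Finset.card_pos.1 (Nat.cast_pos.1 hpos1)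
    exact Nat.cast_pos.2 (Finset.card_pos.2
      (G.walkTuples_nonempty (G.mem_walkTuples.1 hf 0 1 rfl) (k + 1)))
  have h10 : W 1 ≤ W 0 ^ 2 := by
    have : (G.walkTuples 2).card ≤ Fintype.card V ^ 2 := by
      simpa using Finset.card_le_univ (G.walkTuples 2)
    rw [hW0]
    simp only [hW]
    exact_mod_cast this
  apply gridGraph_isContained_of_card_walkTuples G ht
  set q := t - 1 with hq
  have hterm : ∀ p : Fin (2 * q + 1), W 1 ^ 2 *
      ((G.walkTuples p).card * (G.walkTuples (2 * q - p)).card : ℝ) ≤ W 0 ^ 3 * W (2 * q) :=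
    fun p => shifted_mul_le (N := fun k => ((G.walkTuples k).card : ℝ)) hpos hcs h10
      (by simp [G.card_walkTuples_zero]) (fun m => rfl) (by omega)
  have hsum := Finset.sum_le_sum fun (p : Fin (2 * q + 1)) (_ : p ∈ Finset.univ) => hterm p
  rw [← Finset.mul_sum, Finset.sum_const, Finset.card_univ, Fintype.card_fin, nsmul_eq_mul] at hsum
  have hcast : ((2 * q + 1 : ℕ) : ℝ) = 2 * t - 1 := by
    rw [hq]; push_cast [Nat.cast_sub ht]; ring
  rw [hcast] at hsum
  have hgoal : (t * t * ∑ p : Fin (2 * q + 1),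
      ((G.walkTuples p).card * (G.walkTuples (2 * q - p)).card : ℝ)) < W (2 * q) := by
    refine lt_of_mul_lt_mul_left ?_ hW1sq.le
    calc _ = (t : ℝ) ^ 2 * (W 1 ^ 2 * ∑ p : Fin (2 * q + 1),
          ((G.walkTuples p).card * (G.walkTuples (2 * q - p)).card : ℝ)) := by ring
      _ ≤ (t : ℝ) ^ 2 * ((2 * t - 1) * (W 0 ^ 3 * W (2 * q))) :=
        mul_le_mul_of_nonneg_left hsum (sq_nonneg _)
      _ = (2 * t - 1) * t ^ 2 * W 0 ^ 3 * W (2 * q) := by ring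
      _ < W 1 ^ 2 * W (2 * q) := mul_lt_mul_of_pos_right h (hpos _)
  simp only [hW] at hgoal
  exact_mod_cast hgoal

theorem theorem3 (t : ℕ) (ht : 0 < t) :
    ∃ n₀ : ℕ, ∀ n : ℕ, n₀ ≤ n →
      (SimpleGraph.extremalNumber n (gridGraph t) : ℝ) ≤
        5 * (t : ℝ) ^ (3 / 2 : ℝ) * (n : ℝ) ^ (3 / 2 : ℝ) := by
  -- The bound needs no largeness of `n`.
  refine ⟨0, fun n _ => ?_⟩
  conv_lhs => rw [← Fintype.card_fin n]
  have hpow : ∀ m : ℕ, ((m : ℝ) ^ (3 / 2 : ℝ)) ^ 2 = (m : ℝ) ^ 3 := fun m => by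
    rw [← Real.rpow_natCast, ← Real.rpow_mul (Nat.cast_nonneg m), ← Real.rpow_natCast]
    norm_num
  have ht1 : (1 : ℝ) ≤ t := by exact_mod_cast ht
  refine (SimpleGraph.extremalNumber_le_iff_of_nonneg _ (by positivity)).2 fun G _ hG => ?_
  by_contra! hlt
  refine hG (gridGraph_isContained_of_sq_card_edgeFinset G ht ?_)
  have hsq := pow_lt_pow_left₀ hlt (by positivity) two_ne_zero
  rw [mul_pow, mul_pow, hpow, hpow] at hsq
  rw [Fintype.card_fin, mul_pow]
  have h3 : (0 : ℝ) ≤ (n : ℝ) ^ 3 := by positivity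
  -- Here `100 = 2 ^ 2 * 5 ^ 2` comes from squaring twice the assumed edge bound; `2` would already
  -- suffice.
  have h4 : (2 * t - 1) * (t : ℝ) ^ 2 ≤ 100 * (t : ℝ) ^ 3 := by
    nlinarith [sq_nonneg (t : ℝ), pow_nonneg (zero_le_one.trans ht1) 3]
  nlinarith [mul_le_mul_of_nonneg_right h4 h3]
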